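/- Let $K$ be a field, let $n,d\ge 2$ be integers, and let $R=K[x_0,\dots,x_n]$. The support of a monomial is the set of variables dividing it. For a set $\Omega$ of monomials of degree $d$ in $R$, let $K[\Omega]\subseteq R$ be the $K$-subalgebra generated by $\Omega$, and let $I_\Omega$ be its defining ideal, that is, the kernel of the $K$-algebra homomorphism $K[w_m : m\in\Omega]\to K[\Omega]$, $w_m\mapsto m$ (so $K[\Omega]\cong K[w_m : m\in\Omega]/I_\Omega$ is the homogeneous coordinate ring of the monomial projection of the Veronese variety parameterized by $\Omega$). The algebra $K[\Omega]$ is called quadratic if $I_\Omega$ is generated by homogeneous polynomials of degree $2$. Theorem. If $\Omega$ is a set of monomials of degree $d$ in $R$ that contains every monomial of degree $d$ supported in at most $\left\lceil\frac{n+2}{2}\right\rceil$ variables, then $K[\Omega]$ is quadratic. In particular, for every integer $s\ge\left\lceil\frac{n+2}{2}\right\rceil$, the pinched Veronese algebra $\mathrm{PV}(n,d,s)$, that is, the $K$-algebra generated by all monomials of degree $d$ in $x_0,\dots,x_n$ supported in at most $s$ variables, is quadratic. -/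

import Mathlib

/-- A monomial `x₀^(a 0) ⋯ xₙ^(a n)` is given by its exponent vector `a : Fin (n + 1) →₀ ℕ`, and its
support (the set of variables dividing it) is `a.support`. This is the set `M_{n,d}` of all
monomials of degree `d` in the `n + 1` variables `x₀, …, xₙ`. -/
def monomialsOfDegree (n d : ℕ) : Set (Fin (n + 1) →₀ ℕ) :=
  {a | a.degree = d}

/-- The monomials of degree `d` in `x₀, …, xₙ` that are supported in at most `s` variables. -/
def pinchedMonomials (n d s : ℕ) : Set (Fin (n + 1) →₀ ℕ) :=
  {a | a ∈ monomialsOfDegree n d ∧ a.support.card ≤ s}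

/-- An ideal of a polynomial ring is generated by quadrics if the homogeneous polynomials
of degree two that it contains generate it. -/
def GeneratedByQuadrics {K : Type*} [Field K] {σ : Type*} (I : Ideal (MvPolynomial σ K)) : Prop :=
  Ideal.span {q : MvPolynomial σ K | q ∈ I ∧ q.IsHomogeneous 2} = I

/-- The defining ideal of a `K`-algebra `A` with respect to a family `g` of elements of `A`:
the kernel of the map of `K`-algebras `K[w_i : i ∈ σ] → A`, `w_i ↦ g i`. -/
noncomputable def definingIdeal (K : Type*) [Field K] {σ A : Type*} [CommRing A] [Algebra K A]
    (g : σ → A) : Ideal (MvPolynomial σ K) :=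
  RingHom.ker (MvPolynomial.aeval g : MvPolynomial σ K →ₐ[K] A)

/-- A `K`-algebra `A` is quadratic with respect to the family `g` (its standard generators, of
degree one) if `g` generates `A` as a `K`-algebra, so that `A` is the quotient of the polynomial
ring `K[w_i : i ∈ σ]` by the defining ideal, and the defining ideal is generated by quadrics. -/
def IsQuadraticAlgebra (K : Type*) [Field K] {σ A : Type*} [CommRing A] [Algebra K A]
    (g : σ → A) : Prop :=
  Algebra.adjoin K (Set.range g) = ⊤ ∧ GeneratedByQuadrics (definingIdeal K g)

/-- The monomial (toric) algebra `K[Ω] ⊆ K[x₀, …, xₙ]` generated by the monomials in `Ω`. -/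
noncomputable def monomialAlgebra (K : Type*) [Field K] {n : ℕ} (Ω : Set (Fin (n + 1) →₀ ℕ)) :
    Subalgebra K (MvPolynomial (Fin (n + 1)) K) :=
  Algebra.adjoin K ((fun a => MvPolynomial.monomial a (1 : K)) '' Ω)

/-- The monomials in `Ω`, as elements of `K[Ω]`. -/
noncomputable def monomialGenerators (K : Type*) [Field K] {n : ℕ} (Ω : Set (Fin (n + 1) →₀ ℕ)) :
    Ω → monomialAlgebra K Ω :=
  fun a => ⟨MvPolynomial.monomial a.1 (1 : K),
    Algebra.subset_adjoin (Set.mem_image_of_mem _ a.2)⟩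

/-- The pinched Veronese algebra `PV(n,d,s)`: the `K`-algebra generated by all monomials of degree
`d` in `x₀, …, xₙ` that are supported in at most `s` variables. -/
noncomputable abbrev pinchedVeronese (K : Type*) [Field K] (n d s : ℕ) :
    Subalgebra K (MvPolynomial (Fin (n + 1)) K) :=
  monomialAlgebra K (pinchedMonomials n d s)

/-- The standard generators of `PV(n,d,s)`: all monomials of degree `d` supported in at most
`s` variables. -/
noncomputable abbrev pinchedVeroneseGenerators (K : Type*) [Field K] (n d s : ℕ) :
    pinchedMonomials n d s → pinchedVeronese K n d s :=
  monomialGenerators K (pinchedMonomials n d s)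

/-!
Monomials are exponent vectors, so that a factorization of `b` is a multiset of vectors with sum
`b`. Modulo the ideal generated by the quadrics in the defining ideal, the product of the variables
`w_m` over a factorization is unchanged when two factors are replaced by two others with the same
product. So the theorem says that any two factorizations into members of `Ω` of the same monomial
are connected by such exchanges; this is enough because `K[w_m : m ∈ Ω] → K[x₀, …, xₙ]` sends
monomials to monomials (`aeval_eq_zero_of_mem_definingIdeal`). To express connectedness, a map `W`
from monomials to a commutative monoid is fixed whose products are invariant under exchanges, and
different factorizations are shown to have the same `W`-product.

Write `s` for the permitted number of variables, so that there are at most `2 s - 1` variables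
altogether, and call a monomial of degree `d` in at most `s` variables small. Every monomial of
degree `2 d` is a product of two small ones (`exists_isSmall_add`): order the variables and cut in
the middle; the ordering has to be chosen so that the cut falls into the `s`-th variable. Hence it
is enough to consider factorizations into small monomials (`exists_isSmall_prod_map_eq`).

For at least four factors one inducts on their number: if `m` and `m'` are factors of two
factorizations of `b`, then `b / lcm (m, m')` has degree at least `2 d`, hence is divisible by a
small monomial `c`, and both factorizations can be changed to contain `c`
(`prod_map_eq_of_isSmall`).

For three factors (`IsExchangeable.triple_eq`), suppose that there are exactly `2 s - 1` variables
and let `y` be the one with the smallest exponent in `b`. Being light, `y` can be moved completely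
into one factor `m` (`exists_isSmall_split_gather`, `exists_reachesValue_full`). Then `y` no longer
occurs in `b / m`, and this missing variable gives enough room to replace a single other variable
`x` of `m` by any other `z` dividing `b / m`: the monomials `m` and `m z / x` have a common partner
`c` (`exists_split_avoiding`, `ReachesValue.unit_swap`). Only the bound on the support of `m z / x`
may prevent this, and then `m` contains `s` variables. If the replacements have been carried on as
far as possible, all of them but one have their full exponent from `b`, so that `b / m` has few
variables and whole powers can be replaced (`ReachesValue.full_swap`). So `m` can be brought to a
normal form, namely the full power of `y` times a greedy product of the variables with the highest
exponents in `b` (`ReachesValue.exists_isGreedy`, `IsGreedy.eq`). Finally, two factorizations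
sharing `m` differ by a single exchange.
-/

/-! ### Splitting a monomial of degree `2 d` -/

section Splitting

/-- A threshold separates two finite sets of values, one of which lies below the other. -/
theorem exists_threshold {τ : Type*} {f : τ → ℕ} {A B : Finset τ}
    (h : ∀ a ∈ A, ∀ b ∈ B, f a ≤ f b) : ∃ μ, (∀ a ∈ A, f a ≤ μ) ∧ ∀ b ∈ B, μ ≤ f b :=
  ⟨A.sup f, fun _ ha => Finset.le_sup ha, fun b hb => Finset.sup_le fun a ha => h a ha b hb⟩

theorem sum_le_sum_of_forall_le {τ : Type*} {f : τ → ℕ} {A B : Finset τ}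
    (h : ∀ a ∈ A, ∀ b ∈ B, f a ≤ f b) (hc : A.card ≤ B.card) :
    ∑ a ∈ A, f a ≤ ∑ b ∈ B, f b := by
  obtain ⟨μ, h1, h2⟩ := exists_threshold h
  calc ∑ a ∈ A, f a ≤ A.card • μ := Finset.sum_le_card_nsmul _ _ _ h1
    _ ≤ B.card • μ := Nat.mul_le_mul_right _ hc
    _ ≤ _ := Finset.card_nsmul_le_sum _ _ _ h2

/-- The set of variables dividing the monomial with exponent vector `a`. -/
def varSupport {τ : Type*} [Fintype τ] (a : τ → ℕ) : Finset τ :=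
  Finset.univ.filter (a · ≠ 0)

@[simp]
theorem mem_varSupport {τ : Type*} [Fintype τ] {a : τ → ℕ} {i : τ} :
    i ∈ varSupport a ↔ a i ≠ 0 := by
  simp [varSupport]

/-- Exponent vectors of degree `d` with at most `s` nonzero entries. -/
def IsSmall {τ : Type*} [Fintype τ] (s d : ℕ) (a : τ → ℕ) : Prop :=
  ∑ i, a i = d ∧ (varSupport a).card ≤ s

theorem card_support_le {τ : Type*} [Fintype τ] {a : τ → ℕ} {A : Finset τ} {s : ℕ}
    (h : ∀ i, a i ≠ 0 → i ∈ A) (hA : A.card ≤ s) :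
    (varSupport a).card ≤ s :=
  (Finset.card_le_card fun i hi => h i (mem_varSupport.1 hi)).trans hA

/-- Splitting `w` along an ordering of the variables: first those in `C`, then `v`, then the rest.
The cut between the two parts falls into `v`, which is the only variable they may share. -/
theorem exists_split_of_cut {τ : Type*} [Fintype τ] [DecidableEq τ] {w : τ → ℕ} {p q : ℕ}
    (hw : ∑ i, w i = p + q) {C : Finset τ} {v : τ} (hv : v ∉ C)
    (h1 : ∑ i ∈ C, w i ≤ p) (h2 : p ≤ ∑ i ∈ C, w i + w v) :
    ∃ c e : τ → ℕ, c + e = w ∧ ∑ i, c i = p ∧ ∑ i, e i = q ∧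
      (∀ i, c i ≠ 0 → i ∈ insert v C) ∧ ∀ i, e i ≠ 0 → i ∉ C := by
  let c : τ → ℕ := fun i => if i ∈ C then w i else if i = v then p - ∑ i ∈ C, w i else 0
  have hc : c ≤ w := by
    intro i
    by_cases hi : i ∈ C
    · simp [c, hi]
    · by_cases hiv : i = v
      · subst hiv; simp only [c, hi, if_false, if_true]; omega
      · simp [c, hi, hiv]
  have hcs : ∑ i, c i = p := by
    have h3 : ∑ i, c i = ∑ i ∈ insert v C, c i := by
      refine (Finset.sum_subset (Finset.subset_univ _) fun i _ hi => ?_).symm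
      rw [Finset.mem_insert, not_or] at hi
      simp [c, hi.1, hi.2]
    have h4 : ∑ i ∈ C, c i = ∑ i ∈ C, w i := Finset.sum_congr rfl fun i hi => by simp [c, hi]
    have h5 : c v = p - ∑ i ∈ C, w i := by simp [c, hv]
    rw [h3, Finset.sum_insert hv, h4, h5]
    omega
  have hadd : c + (w - c) = w := add_tsub_cancel_of_le hc
  refine ⟨c, w - c, hadd, hcs, ?_, ?_, ?_⟩
  · have h4 : ∑ i, c i + ∑ i, (w - c) i = ∑ i, w i := by
      rw [← Finset.sum_add_distrib]; exact Finset.sum_congr rfl fun i _ => congrFun hadd i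
    omega
  · intro i hi
    by_contra hcon
    rw [Finset.mem_insert, not_or] at hcon
    exact hi (by simp [c, hcon.1, hcon.2])
  · intro i hi hiC
    exact hi (by simp [c, hiC])

/-- Let `C` be of maximal weight among the `k`-subsets of `R` of weight at most `p`. Either some
element of `A \ C` brings the weight up to `p` or more, or no element does so, and then `C` consists
of heaviest elements of `R`, as an element of `C` could be exchanged for a heavier one. -/
theorem exists_cut_or_heaviest {τ : Type*} [DecidableEq τ] (w : τ → ℕ) {R A : Finset τ}
    (hRA : R ⊆ A) {k p : ℕ} (hex : ∃ C ⊆ R, C.card = k ∧ ∑ i ∈ C, w i ≤ p) :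
    ∃ C ⊆ R, C.card = k ∧ ∑ i ∈ C, w i ≤ p ∧
      ((∃ v ∈ A \ C, p ≤ ∑ i ∈ C, w i + w v) ∨
        ((∀ v ∈ A \ C, ∑ i ∈ C, w i + w v < p) ∧ ∀ v ∈ R \ C, ∀ c ∈ C, w v ≤ w c)) := by
  obtain ⟨C, hC, hmax⟩ := Finset.exists_max_image
    (R.powerset.filter fun C => C.card = k ∧ ∑ i ∈ C, w i ≤ p) (fun C => ∑ i ∈ C, w i)
    (by obtain ⟨C, h1, h2⟩ := hex
        exact ⟨C, Finset.mem_filter.2 ⟨Finset.mem_powerset.2 h1, h2⟩⟩)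
  rw [Finset.mem_filter, Finset.mem_powerset] at hC
  refine ⟨C, hC.1, hC.2.1, hC.2.2, ?_⟩
  by_cases hv : ∃ v ∈ A \ C, p ≤ ∑ i ∈ C, w i + w v
  · exact Or.inl hv
  push Not at hv
  refine Or.inr ⟨hv, fun v hvR c hc => ?_⟩
  by_contra! hlt
  rw [Finset.mem_sdiff] at hvR
  have hvA := hv v (Finset.mem_sdiff.2 ⟨hRA hvR.1, hvR.2⟩)
  have hve : v ∉ C.erase c := fun h => hvR.2 (Finset.mem_of_mem_erase h)
  have hs : ∑ i ∈ insert v (C.erase c), w i + w c = w v + ∑ i ∈ C, w i := by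
    rw [Finset.sum_insert hve, add_assoc, Finset.sum_erase_add _ _ hc]
  have hm : insert v (C.erase c) ∈
      R.powerset.filter fun C => C.card = k ∧ ∑ i ∈ C, w i ≤ p := by
    refine Finset.mem_filter.2 ⟨Finset.mem_powerset.2 (Finset.insert_subset hvR.1
      ((Finset.erase_subset _ _).trans hC.1)), ?_, by omega⟩
    rw [Finset.card_insert_of_notMem hve, Finset.card_erase_add_one hc, hC.2.1]
  have := hmax _ hm
  omega

/-- One of two disjoint `k`-subsets has at most half the weight. -/
theorem exists_half_le {τ : Type*} [DecidableEq τ] (w : τ → ℕ) {R : Finset τ} {k p : ℕ}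
    (hR : 2 * k ≤ R.card) (hw : ∑ i ∈ R, w i ≤ 2 * p + 1) :
    ∃ C ⊆ R, C.card = k ∧ ∑ i ∈ C, w i ≤ p := by
  obtain ⟨C, hC, hCk⟩ := Finset.exists_subset_card_eq (show k ≤ R.card by omega)
  have h1 := Finset.sum_sdiff (f := w) hC
  have h2 := Finset.card_sdiff_add_card_eq_card hC
  by_cases h : ∑ i ∈ C, w i ≤ p
  · exact ⟨C, hC, hCk, h⟩
  obtain ⟨C', hC', hCk'⟩ := Finset.exists_subset_card_eq (show k ≤ (R \ C).card by omega)
  refine ⟨C', hC'.trans Finset.sdiff_subset, hCk', ?_⟩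
  have := Finset.sum_le_sum_of_subset (f := w) hC'
  omega

variable {τ : Type*} [Fintype τ] [DecidableEq τ] {s d : ℕ}

theorem sum_compl_add (w : τ → ℕ) (C : Finset τ) :
    ∑ i ∈ Cᶜ, w i + ∑ i ∈ C, w i = ∑ i, w i := by
  rw [add_comm]; exact Finset.sum_add_sum_compl C w

/-- The cut has to fall into the `s`-th variable. If `C` is a set of `s - 1` variables of maximal
weight at most `d`, then some variable completes it to weight at least `d`: otherwise `C` is heavier
than its complement with any one variable removed, and the total weight is less than `2 d`. -/
theorem exists_isSmall_split (hτ : Fintype.card τ + 1 = 2 * s) {w : τ → ℕ}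
    (hw : ∑ i, w i = 2 * d) : ∃ c e, IsSmall s d c ∧ IsSmall s d e ∧ c + e = w := by
  have key : ∃ C : Finset τ, C.card + 1 = s ∧ ∑ i ∈ C, w i ≤ d ∧
      ∃ v, v ∉ C ∧ d ≤ ∑ i ∈ C, w i + w v := by
    obtain ⟨C, -, hCk, hCd, h | ⟨h1, h2⟩⟩ := exists_cut_or_heaviest w (Finset.Subset.refl .univ)
      (exists_half_le w (R := .univ) (k := s - 1) (p := d) (by rw [Finset.card_univ]; omega)
        (by omega))
    · obtain ⟨v, hv, hvd⟩ := h
      exact ⟨C, by omega, hCd, v, (Finset.mem_sdiff.1 hv).2, hvd⟩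
    exfalso
    have hcc := Finset.card_compl_add_card C
    obtain ⟨v, hv⟩ := Finset.card_pos.1 (show 0 < Cᶜ.card by omega)
    have h3 : ∑ i ∈ Cᶜ.erase v, w i ≤ ∑ i ∈ C, w i := by
      refine sum_le_sum_of_forall_le (fun a ha b hb => h2 a ?_ b hb) ?_
      · simpa using (Finset.mem_erase.1 ha).2
      · rw [Finset.card_erase_of_mem hv]; omega
    have h4 := Finset.sum_erase_add _ w hv
    have h5 := sum_compl_add w C
    have h6 := h1 v (by simpa using hv)
    omega
  obtain ⟨C, hC, hCd, v, hv, hvd⟩ := key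
  obtain ⟨c, e, hce, hc, he, hsc, hse⟩ :=
    exists_split_of_cut (p := d) (q := d) (by omega) hv hCd hvd
  have hcc := Finset.card_compl_add_card C
  refine ⟨c, e, ⟨hc, card_support_le hsc ?_⟩, ⟨he, card_support_le (A := Cᶜ) ?_ ?_⟩, hce⟩
  · rw [Finset.card_insert_of_notMem hv]; omega
  · intro i hi; simpa using hse i hi
  · omega

/-- A variable `y` which is not too heavy can be moved completely into the first factor. -/
theorem exists_isSmall_split_gather (hτ : Fintype.card τ + 1 = 2 * s) (hs : 2 ≤ s) {w : τ → ℕ}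
    (hw : ∑ i, w i = 2 * d) {y : τ} (hy : (2 * s - 1) * w y ≤ 3 * d) :
    ∃ c e, IsSmall s d c ∧ IsSmall s d e ∧ c + e = w ∧ e y = 0 := by
  have hR : ({y}ᶜ : Finset τ).card + 2 = 2 * s := by
    rw [Finset.card_compl, Finset.card_singleton]; omega
  have hRw : ∑ i ∈ ({y}ᶜ : Finset τ), w i + w y = 2 * d := by
    rw [← hw, ← sum_compl_add w {y}, Finset.sum_singleton]
  -- the lightest `s - 2` variables other than `y` leave room for `y`
  have hex : ∃ C ⊆ ({y}ᶜ : Finset τ), C.card = s - 2 ∧ ∑ i ∈ C, w i + w y ≤ d := by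
    obtain ⟨C, hC, hmin⟩ := Finset.exists_min_image
      (Finset.powersetCard (s - 2) ({y}ᶜ : Finset τ)) (fun C => ∑ i ∈ C, w i)
      (Finset.powersetCard_nonempty.2 (by omega))
    rw [Finset.mem_powersetCard] at hC
    refine ⟨C, hC.1, hC.2, ?_⟩
    by_contra! hlt
    have hle : ∀ c ∈ C, ∀ v ∈ ({y}ᶜ : Finset τ) \ C, w c ≤ w v := by
      intro c hc v hv
      by_contra! hlt
      rw [Finset.mem_sdiff] at hv
      have hve : v ∉ C.erase c := fun h => hv.2 (Finset.mem_of_mem_erase h)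
      have hs : ∑ i ∈ insert v (C.erase c), w i + w c = w v + ∑ i ∈ C, w i := by
        rw [Finset.sum_insert hve, add_assoc, Finset.sum_erase_add _ _ hc]
      have := hmin (insert v (C.erase c)) (Finset.mem_powersetCard.2
        ⟨Finset.insert_subset hv.1 ((Finset.erase_subset _ _).trans hC.1), by
          rw [Finset.card_insert_of_notMem hve, Finset.card_erase_add_one hc, hC.2]⟩)
      omega
    obtain ⟨μ, h1, h2⟩ := exists_threshold hle
    have h3 := Finset.sum_le_card_nsmul _ _ _ h1
    have h4 := Finset.card_nsmul_le_sum _ _ _ h2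
    have h5 := Finset.sum_sdiff (f := w) hC.1
    have h6 := Finset.card_sdiff_add_card_eq_card hC.1
    rw [show (({y}ᶜ : Finset τ) \ C).card = s by omega] at h4
    rw [hC.2] at h3
    simp only [smul_eq_mul] at h3 h4
    obtain ⟨t, rfl⟩ : ∃ t, s = t + 2 := ⟨s - 2, by omega⟩
    simp only [Nat.add_sub_cancel] at h3
    rw [show 2 * (t + 2) - 1 = 2 * t + 3 by omega] at hy
    set q := w y
    set L := ∑ i ∈ C, w i
    set H := ∑ i ∈ ({y}ᶜ : Finset τ) \ C, w i
    -- `(t + 2) L ≤ t H` since `C` is lightest, and `H < d`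
    have hH : H + 1 ≤ d := by omega
    have h7 : (t + 2) * L ≤ t * H := by nlinarith
    have h8 : (t + 2) * (d + 1) ≤ (t + 2) * q + t * H := by nlinarith
    have h9 : t * H + t ≤ t * d := by nlinarith
    have h10 : 2 * d + 2 * t + 2 ≤ (t + 2) * q := by nlinarith
    have h11 : (2 * t + 3) * (2 * d + 2 * t + 2) ≤ (t + 2) * (3 * d) := by nlinarith
    nlinarith
  -- `y` and `s - 2` further variables come before the cut, the weight of the latter being maximal
  have key : ∃ C : Finset τ, y ∈ C ∧ C.card + 1 = s ∧ ∑ i ∈ C, w i ≤ d ∧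
      ∃ v, v ∉ C ∧ d ≤ ∑ i ∈ C, w i + w v := by
    obtain ⟨C, hC, hCk, hCd, h⟩ := exists_cut_or_heaviest w (k := s - 2) (p := d - w y)
      (Finset.Subset.refl ({y}ᶜ : Finset τ)) (by
        obtain ⟨C, h1, h2, h3⟩ := hex
        exact ⟨C, h1, h2, by omega⟩)
    have hyd : w y ≤ d := by
      obtain ⟨_, _, _, h3⟩ := hex
      omega
    have hyC : y ∉ C := fun h => by simpa using hC h
    rcases h with ⟨v, hv, hvd⟩ | ⟨h1, h2⟩
    · rw [Finset.mem_sdiff, Finset.mem_compl, Finset.mem_singleton] at hv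
      refine ⟨insert y C, Finset.mem_insert_self _ _, ?_, ?_, v, ?_, ?_⟩
      · rw [Finset.card_insert_of_notMem hyC]; omega
      · rw [Finset.sum_insert hyC]; omega
      · simp [hv.1, hv.2]
      · rw [Finset.sum_insert hyC]; omega
    exfalso
    have h6 := Finset.card_sdiff_add_card_eq_card hC
    obtain ⟨u, hu⟩ := Finset.card_pos.1 (show 0 < (({y}ᶜ : Finset τ) \ C).card by omega)
    have hcu := Finset.card_erase_add_one hu
    obtain ⟨v, hv⟩ := Finset.card_pos.1 (show 0 < ((({y}ᶜ : Finset τ) \ C).erase u).card by omega)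
    have hcv := Finset.card_erase_add_one hv
    have h3 : ∑ i ∈ ((({y}ᶜ : Finset τ) \ C).erase u).erase v, w i ≤ ∑ i ∈ C, w i :=
      sum_le_sum_of_forall_le (fun a ha b hb =>
        h2 a (Finset.mem_of_mem_erase (Finset.mem_of_mem_erase ha)) b hb) (by omega)
    have h4 := Finset.sum_erase_add _ w hv
    have h5 := Finset.sum_erase_add _ w hu
    have h7 := h1 u hu
    have h8 := h1 v (Finset.mem_of_mem_erase hv)
    have h9 := Finset.sum_sdiff (f := w) hC
    omega
  obtain ⟨C, hyC, hC, hCd, v, hv, hvd⟩ := key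
  obtain ⟨c, e, hce, hc, he, hsc, hse⟩ :=
    exists_split_of_cut (p := d) (q := d) (by omega) hv hCd hvd
  have hcc := Finset.card_compl_add_card C
  refine ⟨c, e, ⟨hc, card_support_le hsc ?_⟩, ⟨he, card_support_le (A := Cᶜ) ?_ ?_⟩, hce, ?_⟩
  · rw [Finset.card_insert_of_notMem hv]; omega
  · intro i hi; simpa using hse i hi
  · omega
  · by_contra h; exact hse y h hyC

/-- If the variable `y` does not occur in `w`, then `w` splits so that the second factor can be
multiplied by `x` or by `z` without its support exceeding `s` variables. The absence of `y` leaves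
an even number of variables other than `x` and `z`, half of which weigh at least as much as the
other half if they are heaviest. -/
theorem exists_split_avoiding (hτ : Fintype.card τ + 1 = 2 * s) (hs : 2 ≤ s) {w : τ → ℕ}
    (hw : ∑ i, w i + 1 = 2 * d) {x y z : τ} (hxy : x ≠ y) (hzy : z ≠ y) (hxz : x ≠ z)
    (hy : w y = 0) :
    ∃ c e : τ → ℕ, IsSmall s d c ∧ ∑ i, e i + 1 = d ∧ c + e = w ∧
      ∃ B : Finset τ, B.card ≤ s ∧ x ∈ B ∧ z ∈ B ∧ ∀ i, e i ≠ 0 → i ∈ B := by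
  have hR : ({y, x, z}ᶜ : Finset τ).card + 4 = 2 * s := by
    rw [Finset.card_compl, Finset.card_insert_of_notMem (by simp [hxy.symm, hzy.symm]),
      Finset.card_pair hxz]; omega
  have hRw : ∑ i ∈ ({y, x, z}ᶜ : Finset τ), w i + (w x + w z) = ∑ i, w i := by
    rw [← sum_compl_add w {y, x, z}, Finset.sum_insert (by simp [hxy.symm, hzy.symm]),
      Finset.sum_pair hxz, hy, zero_add]
  -- `x` and `z` come after the cut, so that only `s - 2` of the other variables come before it
  have key : ∃ C : Finset τ, y ∉ C ∧ x ∉ C ∧ z ∉ C ∧ C.card + 2 = s ∧ ∑ i ∈ C, w i ≤ d ∧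
      ∃ v, v ∉ C ∧ d ≤ ∑ i ∈ C, w i + w v := by
    obtain ⟨C, hC, hCk, hCd, h⟩ := exists_cut_or_heaviest w (k := s - 2) (p := d)
      (Finset.subset_univ _) (exists_half_le w (R := ({y, x, z}ᶜ : Finset τ)) (by omega) (by omega))
    have hn : ∀ i ∈ C, i ≠ y ∧ i ≠ x ∧ i ≠ z := fun i hi => by simpa using hC hi
    have hCs : C.card + 2 = s := by clear h; omega
    refine ⟨C, fun h => (hn _ h).1 rfl, fun h => (hn _ h).2.1 rfl, fun h => (hn _ h).2.2 rfl,
      hCs, hCd, ?_⟩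
    rcases h with ⟨v, hv, hvd⟩ | ⟨h1, h2⟩
    · exact ⟨v, (Finset.mem_sdiff.1 hv).2, hvd⟩
    exfalso
    have h3 := Finset.card_sdiff_add_card_eq_card hC
    have h4 := sum_le_sum_of_forall_le h2 (by omega)
    have h5 := Finset.sum_sdiff (f := w) hC
    have h6 := h1 x (by simpa using fun h => (hn _ h).2.1 rfl)
    have h7 := h1 z (by simpa using fun h => (hn _ h).2.2 rfl)
    omega
  obtain ⟨C, hyC, hxC, hzC, hC, hCd, v, hv, hvd⟩ := key
  obtain ⟨c, e, hce, hc, he, hsc, hse⟩ :=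
    exists_split_of_cut (p := d) (q := d - 1) (by omega) hv hCd hvd
  refine ⟨c, e, ⟨hc, card_support_le hsc ?_⟩, by omega, hce, Cᶜ.erase y, ?_, ?_, ?_, ?_⟩
  · rw [Finset.card_insert_of_notMem hv]; omega
  · rw [Finset.card_erase_of_mem (by simpa using hyC)]
    have := Finset.card_compl_add_card C
    omega
  · simp [hxy, hxC]
  · simp [hzy, hzC]
  · intro i hi
    have : i ≠ y := by
      rintro rfl
      have := congrFun hce i
      simp only [Pi.add_apply, hy] at this
      omega
    simpa [this] using hse i hi

end Splitting

/-! ### Factorizations into three monomials -/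

section Triples

variable {τ : Type*} [Fintype τ] {s d : ℕ} {A : Type*} [CommMonoid A]

/-- The map `W` respects the quadratic relations between factors of `b`: its values on two small
exponent vectors multiply to an element depending only on their sum. -/
def IsExchangeable (s d : ℕ) (b : τ → ℕ) (W : (τ → ℕ) → A) : Prop :=
  ∀ a₁ a₂ a₁' a₂', IsSmall s d a₁ → IsSmall s d a₂ → IsSmall s d a₁' → IsSmall s d a₂' →
    a₁ + a₂ ≤ b → a₁ + a₂ = a₁' + a₂' → W a₁ * W a₂ = W a₁' * W a₂'

/-- The small exponent vector `m` is part of a factorization of `b` into three small exponent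
vectors whose `W`-value is `v`. For exchangeable `W` the value `v` is determined by `m`. -/
def ReachesValue (s d : ℕ) (b : τ → ℕ) (W : (τ → ℕ) → A) (v : A) (m : τ → ℕ) : Prop :=
  IsSmall s d m ∧ ∃ c e, IsSmall s d c ∧ IsSmall s d e ∧ m + c + e = b ∧ W m * W c * W e = v

variable {b : τ → ℕ} {W : (τ → ℕ) → A} {v : A}

theorem ReachesValue.eq (hW : IsExchangeable s d b W) {m c e : τ → ℕ}
    (hm : ReachesValue s d b W v m) (hc : IsSmall s d c) (he : IsSmall s d e)
    (h : m + c + e = b) : W m * W c * W e = v := by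
  obtain ⟨-, c', e', hc', he', h', rfl⟩ := hm
  have : c + e = c' + e' := add_left_cancel (a := m) (by rw [← add_assoc, ← add_assoc, h, h'])
  rw [mul_assoc, mul_assoc, hW c e c' e' hc he hc' he' ?_ this]
  rw [← h, add_assoc]
  exact le_add_self

theorem ReachesValue.le {m : τ → ℕ} (hm : ReachesValue s d b W v m) : m ≤ b := by
  obtain ⟨-, c, e, -, -, h, -⟩ := hm
  rw [← h, add_assoc]
  exact le_self_add

/-- Apart from `y`, the factor `m` of `b` uses the variables in decreasing order of the ranking
`r`, exhausting each of them in `b` before using the next one. -/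
def IsGreedy (b : τ → ℕ) (y : τ) (r : τ → ℕ) (m : τ → ℕ) : Prop :=
  ∀ x z, x ≠ y → r x < r z → m x ≠ 0 → m z = b z

theorem IsGreedy.eq {y : τ} {r : τ → ℕ} (hr : r.Injective) {m m' : τ → ℕ}
    (hm : IsGreedy b y r m) (hm' : IsGreedy b y r m') (hmb : m ≤ b) (hmb' : m' ≤ b)
    (hy : m y = m' y) (h : ∑ i, m i = ∑ i, m' i) : m = m' := by
  by_contra hne
  have hlt : ∃ x, m x < m' x := by
    by_contra! hcon
    exact hne (funext fun i => ((Finset.sum_eq_sum_iff_of_le fun i _ => hcon i).1 h.symm i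
      (Finset.mem_univ i)).symm)
  have hgt : ∃ z, m' z < m z := by
    by_contra! hcon
    exact hne (funext fun i => (Finset.sum_eq_sum_iff_of_le fun i _ => hcon i).1 h i
      (Finset.mem_univ i))
  obtain ⟨x, hx⟩ := hlt
  obtain ⟨z, hz⟩ := hgt
  have hxy : x ≠ y := by rintro rfl; omega
  have hzy : z ≠ y := by rintro rfl; omega
  have h1 : m z ≤ b z := hmb z
  have h2 : m' x ≤ b x := hmb' x
  rcases lt_trichotomy (r x) (r z) with h3 | h3 | h3
  · have := hm' x z hxy h3 (by omega)
    omega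
  · have := hr h3
    subst this
    omega
  · have := hm z x hzy h3 (by omega)
    omega

variable [DecidableEq τ]

theorem exists_le_sum_eq {w : τ → ℕ} {p : ℕ} (hp : p ≤ ∑ i, w i) :
    ∃ c e : τ → ℕ, c + e = w ∧ ∑ i, c i = p := by
  induction p with
  | zero => exact ⟨0, w, zero_add w, by simp⟩
  | succ p ih =>
    obtain ⟨c, e, rfl, hc⟩ := ih (by omega)
    have he : ∑ i, e i ≠ 0 := by
      intro h
      simp only [Pi.add_apply, Finset.sum_add_distrib] at hp
      omega
    obtain ⟨i, -, hi⟩ := Finset.exists_ne_zero_of_sum_ne_zero he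
    have h1 : Pi.single i 1 ≤ e := by
      intro j
      by_cases hj : j = i
      · subst hj; simp; omega
      · simp [hj]
    refine ⟨c + Pi.single i 1, e - Pi.single i 1, ?_, ?_⟩
    · rw [add_assoc, add_tsub_cancel_of_le h1]
    · simp [Finset.sum_add_distrib, hc]

theorem exists_add_single {τ : Type*} [DecidableEq τ] {m b : τ → ℕ} (hmb : m ≤ b) {z : τ}
    {k : ℕ} (hk : m z + k ≤ b z) :
    ∃ w, m + Pi.single z k + w = b := by
  have : m + Pi.single z k ≤ b := by
    intro i
    by_cases hi : i = z
    · subst hi; simpa using hk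
    · simpa [hi] using hmb i
  exact ⟨b - (m + Pi.single z k), add_tsub_cancel_of_le this⟩

theorem sum_add_single (m : τ → ℕ) (x : τ) (k : ℕ) :
    ∑ i, (m + Pi.single x k : τ → ℕ) i = ∑ i, m i + k := by
  simp [Finset.sum_add_distrib]

/-- Replacing `x ^ k` by `z ^ k` in a factor `m₀ x ^ k` does not change the value, provided that
`b` has the factorizations `(m₀ x ^ k, c, e z ^ k)` and `(m₀ z ^ k, c, e x ^ k)`, which share
the factor `c`. -/
theorem ReachesValue.swap (hW : IsExchangeable s d b W) {m₀ c e : τ → ℕ} {x z : τ} {k : ℕ}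
    (hm : ReachesValue s d b W v (m₀ + Pi.single x k)) (hm' : IsSmall s d (m₀ + Pi.single z k))
    (hc : IsSmall s d c) (hex : IsSmall s d (e + Pi.single x k))
    (hez : IsSmall s d (e + Pi.single z k))
    (h : m₀ + Pi.single x k + Pi.single z k + (c + e) = b) :
    ReachesValue s d b W v (m₀ + Pi.single z k) := by
  have h1 : m₀ + Pi.single x k + c + (e + Pi.single z k) = b := by rw [← h]; abel
  refine ⟨hm', c, e + Pi.single x k, hc, hex, by rw [← h]; abel, ?_⟩
  rw [← hm.eq hW hc hez h1, mul_right_comm, mul_right_comm _ (W c)]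
  congr 1
  refine hW _ _ _ _ hm' hex hm.1 hez ?_ (by abel)
  rw [← h]
  intro i
  simp only [Pi.add_apply]
  omega

/-- If `m` contains the full power of `y` dividing `b`, then a single `x` in `m` can be replaced
by `z`, unless this makes the support of `m` too large. -/
theorem ReachesValue.unit_swap (hτ : Fintype.card τ + 1 = 2 * s) (hs : 2 ≤ s)
    (hb : ∑ i, b i = 3 * d) (hW : IsExchangeable s d b W) {m₀ : τ → ℕ} {x y z : τ}
    (hm : ReachesValue s d b W v (m₀ + Pi.single x 1)) (hxy : x ≠ y) (hxz : x ≠ z)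
    (hy : m₀ y = b y) (hz : m₀ z < b z)
    (hsupp : m₀ z ≠ 0 ∨ (varSupport (m₀ + Pi.single x 1)).card < s) :
    ReachesValue s d b W v (m₀ + Pi.single z 1) := by
  have hzy : z ≠ y := by rintro rfl; omega
  obtain ⟨w, hw⟩ := exists_add_single hm.le (z := z) (k := 1) (by simpa [hxz.symm] using hz)
  have hsum : ∑ i, m₀ i + 1 = d := by rw [← sum_add_single m₀ x 1]; exact hm.1.1
  have hws : ∑ i, w i + 1 = 2 * d := by
    have : ∑ i, (m₀ + Pi.single x 1 + Pi.single z 1 + w : τ → ℕ) i = 3 * d := by rw [hw, hb]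
    rw [show ∑ i, (m₀ + Pi.single x 1 + Pi.single z 1 + w : τ → ℕ) i =
      ∑ i, (m₀ + Pi.single x 1 + Pi.single z 1 : τ → ℕ) i + ∑ i, w i from Finset.sum_add_distrib,
      sum_add_single, sum_add_single] at this
    omega
  have hwy : w y = 0 := by
    have := congrFun hw y
    simp only [Pi.add_apply, Pi.single_eq_of_ne hxy.symm, Pi.single_eq_of_ne hzy.symm] at this
    omega
  obtain ⟨c, e, hc, he, hce, B, hB, hxB, hzB, heB⟩ :=
    exists_split_avoiding hτ hs hws hxy hzy hxz hwy
  have small : ∀ u ∈ B, IsSmall s d (e + Pi.single u 1) := by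
    refine fun u hu => ⟨by rw [sum_add_single, he], card_support_le (A := B) (fun i hi => ?_) hB⟩
    by_cases hiu : i = u
    · rwa [hiu]
    · exact heB i (by simpa [hiu] using hi)
  refine hm.swap hW ⟨by rw [sum_add_single, hsum], ?_⟩ hc (small x hxB) (small z hzB)
    (by rw [hce, hw])
  by_cases hmz : m₀ z = 0
  · refine card_support_le
      (A := insert z (varSupport (m₀ + Pi.single x 1))) (fun i hi => ?_) ?_
    · by_cases hiz : i = z
      · simp [hiz]
      · have : m₀ i ≠ 0 := by simpa [hiz] using hi
        simp [this]
    · have := Finset.card_insert_le z (varSupport (m₀ + Pi.single x 1))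
      have := hsupp.resolve_left (not_not.2 hmz)
      omega
  · refine card_support_le (fun i hi => ?_) hm.1.2
    by_cases hiz : i = z
    · subst hiz; simp [hmz]
    · have : m₀ i ≠ 0 := by simpa [hiz] using hi
      simp [this]

/-- If all variables of `m` but `x` occur in `m` with their full power in `b`, and `m` is supported
in exactly `s` variables, then the cofactor of `m` involves few variables, and the whole power of
`x` in `m` can be replaced by the same power of a new variable `z`. -/
theorem ReachesValue.full_swap (hτ : Fintype.card τ + 1 = 2 * s)
    (hb : ∑ i, b i = 3 * d) (hW : IsExchangeable s d b W) {m₀ : τ → ℕ} {x z : τ} {k : ℕ}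
    (hm : ReachesValue s d b W v (m₀ + Pi.single x k)) (hk : k ≠ 0) (hx : m₀ x = 0)
    (hz : m₀ z = 0) (hxz : x ≠ z) (hkz : k ≤ b z) (hfull : ∀ u, m₀ u ≠ 0 → m₀ u = b u)
    (hsupp : (varSupport (m₀ + Pi.single x k)).card = s) :
    ReachesValue s d b W v (m₀ + Pi.single z k) := by
  obtain ⟨w, hw⟩ := exists_add_single hm.le (z := z) (k := k) (by simpa [hxz.symm, hz] using hkz)
  have hsum : ∑ i, m₀ i + k = d := by rw [← sum_add_single m₀ x k]; exact hm.1.1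
  have hws : ∑ i, w i + k = 2 * d := by
    have : ∑ i, (m₀ + Pi.single x k + Pi.single z k + w : τ → ℕ) i = 3 * d := by rw [hw, hb]
    rw [show ∑ i, (m₀ + Pi.single x k + Pi.single z k + w : τ → ℕ) i =
      ∑ i, (m₀ + Pi.single x k + Pi.single z k : τ → ℕ) i + ∑ i, w i from Finset.sum_add_distrib,
      sum_add_single, sum_add_single] at this
    omega
  obtain ⟨c, e, hce, hc⟩ := exists_le_sum_eq (w := w) (p := d) (by omega)
  have hes : ∑ i, e i + k = d := by
    rw [← hce] at hws
    simp only [Pi.add_apply, Finset.sum_add_distrib] at hws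
    omega
  have hM : varSupport (m₀ + Pi.single x k) =
      insert x (varSupport m₀) := by
    ext i
    by_cases hix : i = x
    · subst hix; simp [hk]
    · simp [hix]
  have hMc : (varSupport m₀).card + 1 = s := by
    rw [← hsupp, hM, Finset.card_insert_of_notMem (by simp [hx])]
  let Q : Finset τ := (varSupport m₀)ᶜ
  have hQ : Q.card ≤ s := by
    have := Finset.card_compl_add_card (varSupport m₀)
    simp only [Q]
    omega
  have hwQ : ∀ i, w i ≠ 0 → i ∈ Q := by
    intro i hi
    simp only [Q, Finset.mem_compl, mem_varSupport, not_not]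
    by_contra h
    have h1 := hfull i h
    have h2 := congrFun hw i
    simp only [Pi.add_apply] at h2
    omega
  have hcQ : ∀ i, c i ≠ 0 → i ∈ Q := fun i hi => hwQ i (by rw [← hce, Pi.add_apply]; omega)
  have small : ∀ u ∈ Q, IsSmall s d (e + Pi.single u k) := by
    refine fun u hu => ⟨by rw [sum_add_single, hes], card_support_le (A := Q) (fun i hi => ?_) hQ⟩
    by_cases hiu : i = u
    · rwa [hiu]
    · have : e i ≠ 0 := by simpa [hiu] using hi
      exact hwQ i (by rw [← hce, Pi.add_apply]; omega)
  refine hm.swap hW ⟨by rw [sum_add_single, hsum], ?_⟩ ⟨hc, card_support_le hcQ hQ⟩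
    (small x (by simp [Q, hx])) (small z (by simp [Q, hz])) (by rw [hce, hw])
  refine card_support_le (A := insert z (varSupport m₀)) (fun i hi => ?_) ?_
  · by_cases hiz : i = z
    · simp [hiz]
    · have : m₀ i ≠ 0 := by simpa [hiz] using hi
      simp [this]
  · have := Finset.card_insert_le z (varSupport m₀)
    omega

/-- A ranking of the variables by their exponents in `b`, ties being broken arbitrarily. -/
theorem exists_ranking (b : τ → ℕ) :
    ∃ r : τ → ℕ, r.Injective ∧ ∀ x z, r x < r z → b x ≤ b z := by
  let N := Fintype.card τ
  let f := Fintype.equivFin τ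
  have hN : ∀ i, (f i : ℕ) < N := fun i => (f i).2
  have key : ∀ x z, b x < b z → b x * N + f x < b z * N + f z := by
    intro x z h
    have h1 := hN x
    have h2 : (b x + 1) * N ≤ b z * N := Nat.mul_le_mul_right _ h
    rw [Nat.add_mul, Nat.one_mul] at h2
    omega
  refine ⟨fun i => b i * N + f i, fun x z h => ?_, fun x z h => ?_⟩
  · simp only at h
    rcases lt_trichotomy (b x) (b z) with h1 | h1 | h1
    · have := key x z h1; omega
    · rw [h1] at h
      exact f.injective (Fin.ext (by omega))
    · have := key z x h1; omega
  · by_contra! h1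
    have := key z x h1
    simp only at h
    omega

/-- A factor containing the full power of `y` can be made greedy without changing the value. -/
theorem ReachesValue.exists_isGreedy (hτ : Fintype.card τ + 1 = 2 * s) (hs : 2 ≤ s)
    (hb : ∑ i, b i = 3 * d) (hW : IsExchangeable s d b W) {r : τ → ℕ} (hr : r.Injective)
    (hrb : ∀ x z, r x < r z → b x ≤ b z) {y : τ} {m : τ → ℕ}
    (hm : ReachesValue s d b W v m) (hy : m y = b y) :
    ∃ m, ReachesValue s d b W v m ∧ m y = b y ∧ IsGreedy b y r m := by
  obtain ⟨m, ⟨hm, hy⟩, hmax⟩ := Set.exists_max_image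
    {m | ReachesValue s d b W v m ∧ m y = b y} (fun m => ∑ i, m i * r i)
    ((Set.finite_Icc 0 b).subset fun m hm => ⟨fun _ => Nat.zero_le _, hm.1.le⟩) ⟨m, hm, hy⟩
  -- by maximality, no power of a variable can be replaced by one of a variable of higher rank
  have hno : ∀ (m₀ : τ → ℕ) (x z : τ) (k : ℕ), m = m₀ + Pi.single x k →
      k ≠ 0 → x ≠ y → z ≠ y → r x < r z → ¬ ReachesValue s d b W v (m₀ + Pi.single z k) := by
    rintro m₀ x z k rfl hk hxy hzy hlt hcon
    have h1 := hmax _ ⟨hcon, by simpa [hxy.symm, hzy.symm] using hy⟩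
    have h2 : ∀ u, ∑ i, (m₀ + Pi.single u k : τ → ℕ) i * r i = ∑ i, m₀ i * r i + k * r u := by
      intro u
      simp only [Pi.add_apply, add_mul, Finset.sum_add_distrib]
      congr 1
      rw [Finset.sum_eq_single u] <;> simp +contextual
    rw [h2, h2] at h1
    have := Nat.mul_lt_mul_of_pos_left hlt (Nat.pos_of_ne_zero hk)
    omega
  have hdec : ∀ x k, k ≤ m x → ∃ m₀ : τ → ℕ, m = m₀ + Pi.single x k := fun x k hk => by
    refine ⟨m - Pi.single x k, (tsub_add_cancel_of_le fun i => ?_).symm⟩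
    by_cases hi : i = x
    · subst hi; simpa using hk
    · simp [hi]
  have hunit : ∀ x z, x ≠ y → r x < r z → m x ≠ 0 → m z ≠ b z →
      m z = 0 ∧ (varSupport m).card = s := by
    intro x z hxy hlt hx hz
    have hzy : z ≠ y := by rintro rfl; exact hz hy
    have hxz : x ≠ z := by rintro rfl; omega
    have hzb : m z < b z := lt_of_le_of_ne (hm.le z) hz
    by_contra hcon
    obtain ⟨m₀, hm₀⟩ := hdec x 1 (Nat.pos_of_ne_zero hx)
    have hmz : m z = m₀ z := by rw [hm₀]; simp [hxz.symm]
    refine hno m₀ x z 1 hm₀ one_ne_zero hxy hzy hlt ?_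
    have hm2 := hm
    rw [hm₀] at hm2
    refine hm2.unit_swap hτ hs hb hW hxy hxz ?_ (by omega) ?_
    · rw [← hy, hm₀]; simp [hxy.symm]
    · rw [← hm₀, ← hmz]
      have := hm.1.2
      by_contra! h
      exact hcon ⟨h.1, by omega⟩
  refine ⟨m, hm, hy, fun x z hxy hlt hx => ?_⟩
  by_contra hz
  obtain ⟨hz0, hcard⟩ := hunit x z hxy hlt hx hz
  -- every variable of `m` other than `y` and the one of lowest rank, `u`, is exhausted
  obtain ⟨u, hu, humin⟩ := Finset.exists_min_image
    (Finset.univ.filter fun i => m i ≠ 0 ∧ i ≠ y) r ⟨x, by simp [hx, hxy]⟩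
  rw [Finset.mem_filter] at hu
  obtain ⟨-, hu0, huy⟩ := hu
  have hux : r u ≤ r x := humin x (by simp [hx, hxy])
  have hzy : z ≠ y := by rintro rfl; exact hz hy
  have huz : u ≠ z := by rintro rfl; omega
  obtain ⟨m₀, hm₀⟩ := hdec u (m u) le_rfl
  have hm₀u : m₀ u = 0 := by have := congrFun hm₀ u; simpa using this
  have hm₀i : ∀ i, i ≠ u → m i = m₀ i := fun i hi => by rw [hm₀]; simp [hi]
  refine hno m₀ u z (m u) hm₀ hu0 huy hzy (by omega) ?_
  have hm2 := hm
  rw [hm₀] at hm2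
  generalize hk : m u = k at *
  refine hm2.full_swap hτ hb hW hu0 hm₀u (by rw [← hm₀i z huz.symm, hz0]) huz ?_ ?_
    (by rw [← hm₀, hcard])
  · have : m u ≤ b u := hm.le u
    have := hrb u z (by omega)
    omega
  · intro i hi
    have hiu : i ≠ u := by rintro rfl; exact hi hm₀u
    rw [← hm₀i i hiu] at hi ⊢
    by_cases hiy : i = y
    · rw [hiy, hy]
    by_contra hib
    have hlt' : r u < r i := lt_of_le_of_ne (humin i (by simp [hi, hiy])) fun h => hiu (hr h).symm
    exact hi (hunit u i huy hlt' (by omega) hib).1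

/-- The lightest variable `y` of `b` can be moved completely into one factor. -/
theorem exists_reachesValue_full (hτ : Fintype.card τ + 1 = 2 * s) (hs : 2 ≤ s)
    (hb : ∑ i, b i = 3 * d) (hW : IsExchangeable s d b W) {y : τ} (hy : ∀ i, b y ≤ b i)
    {m₁ m₂ m₃ : τ → ℕ} (h₁ : IsSmall s d m₁) (h₂ : IsSmall s d m₂) (h₃ : IsSmall s d m₃)
    (h : m₁ + m₂ + m₃ = b) :
    ∃ m, ReachesValue s d b W (W m₁ * W m₂ * W m₃) m ∧ m y = b y := by
  have hyd : (2 * s - 1) * b y ≤ 3 * d := by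
    have := Finset.card_nsmul_le_sum Finset.univ b (b y) fun i _ => hy i
    rw [hb, Finset.card_univ, smul_eq_mul, show Fintype.card τ = 2 * s - 1 by omega] at this
    exact this
  have gather : ∀ a a' a'' : τ → ℕ, IsSmall s d a → IsSmall s d a' → a + a' + a'' = b →
      ∃ c e, IsSmall s d c ∧ IsSmall s d e ∧ c + e = a + a' ∧ e y = 0 ∧
        W c * W e = W a * W a' := by
    intro a a' a'' ha ha' hab
    have hle : a + a' ≤ b := by rw [← hab]; exact le_self_add
    obtain ⟨c, e, hc, he, hce, hey⟩ := exists_isSmall_split_gather (d := d) hτ hs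
      (w := a + a') (y := y)
      (by simp only [Pi.add_apply, Finset.sum_add_distrib, ha.1, ha'.1]; omega)
      ((Nat.mul_le_mul_left _ (hle y)).trans hyd)
    exact ⟨c, e, hc, he, hce, hey, hW _ _ _ _ hc he ha ha' (by rw [hce]; exact hle) hce⟩
  obtain ⟨c, e, hc, he, hce, hey, hv⟩ := gather m₁ m₂ m₃ h₁ h₂ h
  obtain ⟨c', e', hc', he', hce', hey', hv'⟩ := gather c m₃ e hc h₃
    (by rw [← h, ← hce]; abel)
  have hsum : c' + e' + e = b := by rw [← h, hce', ← hce]; abel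
  refine ⟨c', ⟨hc', e', e, he', he, hsum, ?_⟩, ?_⟩
  · rw [hv', mul_right_comm, hv]
  · rw [← hsum]; simp [hey, hey']

/-- Two factorizations of `b` into three small exponent vectors have the same value. -/
theorem IsExchangeable.triple_eq (hτ : Fintype.card τ + 1 = 2 * s) (hs : 2 ≤ s)
    (hW : IsExchangeable s d b W) {m₁ m₂ m₃ m₁' m₂' m₃' : τ → ℕ}
    (h₁ : IsSmall s d m₁) (h₂ : IsSmall s d m₂) (h₃ : IsSmall s d m₃)
    (h₁' : IsSmall s d m₁') (h₂' : IsSmall s d m₂') (h₃' : IsSmall s d m₃')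
    (h : m₁ + m₂ + m₃ = b) (h' : m₁' + m₂' + m₃' = b) :
    W m₁ * W m₂ * W m₃ = W m₁' * W m₂' * W m₃' := by
  have hb : ∑ i, b i = 3 * d := by
    rw [← h]
    simp only [Pi.add_apply, Finset.sum_add_distrib, h₁.1, h₂.1, h₃.1]
    omega
  have : Nonempty τ := Fintype.card_pos_iff.1 (by omega)
  -- both factorizations lead to the same greedy factor, which determines the value
  obtain ⟨y, hy⟩ := Finite.exists_min b
  obtain ⟨r, hr, hrb⟩ := exists_ranking b
  obtain ⟨m, hm, hmy⟩ := exists_reachesValue_full hτ hs hb hW hy h₁ h₂ h₃ h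
  obtain ⟨m', hm', hmy'⟩ := exists_reachesValue_full hτ hs hb hW hy h₁' h₂' h₃' h'
  obtain ⟨g, hg, hgy, hgr⟩ := hm.exists_isGreedy hτ hs hb hW hr hrb hmy
  obtain ⟨g', hg', hgy', hgr'⟩ := hm'.exists_isGreedy hτ hs hb hW hr hrb hmy'
  obtain rfl := hgr.eq hr hgr' hg.le hg'.le (hgy.trans hgy'.symm) (hg.1.1.trans hg'.1.1.symm)
  obtain ⟨-, c, e, hc, he, hce, hv⟩ := hg
  rw [← hv, hg'.eq hW hc he hce]

end Triples

/-! ### Monomials in a larger set of variables -/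

section Transfer

variable {σ τ : Type*} {s d : ℕ} {ι : σ → τ}

theorem extend_add_extend (hι : ι.Injective) (a b : σ → ℕ) :
    Function.extend ι a 0 + Function.extend ι b 0 = Function.extend ι (a + b) 0 := by
  funext j
  by_cases hj : ∃ i, ι i = j
  · obtain ⟨i, rfl⟩ := hj
    simp [hι.extend_apply]
  · simp [Function.extend_apply' _ _ _ hj]

theorem extend_comp_of_le (hι : ι.Injective) {c : τ → ℕ} {w : σ → ℕ}
    (hc : c ≤ Function.extend ι w 0) : Function.extend ι (c ∘ ι) 0 = c := by
  funext j
  by_cases hj : ∃ i, ι i = j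
  · obtain ⟨i, rfl⟩ := hj
    simp [hι.extend_apply]
  · have : c j ≤ Function.extend ι w 0 j := hc j
    rw [Function.extend_apply' _ _ _ hj] at this ⊢
    exact (Nat.le_zero.1 this).symm

variable [Fintype σ] [Fintype τ]

theorem sum_extend_zero (hι : ι.Injective) (a : σ → ℕ) :
    ∑ j, Function.extend ι a 0 j = ∑ i, a i :=
  (Fintype.sum_of_injective ι hι _ _ (fun j hj => Function.extend_apply' a (0 : τ → ℕ) j hj)
    fun i => (hι.extend_apply a 0 i).symm).symm

theorem IsSmall.extend (hι : ι.Injective) {a : σ → ℕ} (ha : IsSmall s d a) :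
    IsSmall s d (Function.extend ι a 0) := by
  refine ⟨(sum_extend_zero hι a).trans ha.1,
    card_support_le (A := (varSupport a).map ⟨ι, hι⟩) (fun j hj => ?_) (by simpa using ha.2)⟩
  by_cases h : ∃ i, ι i = j
  · obtain ⟨i, rfl⟩ := h
    rw [hι.extend_apply] at hj
    simpa [hι.eq_iff] using hj
  · exact absurd (Function.extend_apply' _ _ _ h) hj

theorem IsSmall.restrict (hι : ι.Injective) {c : τ → ℕ} {w : σ → ℕ} (h : IsSmall s d c)
    (hc : c ≤ Function.extend ι w 0) : IsSmall s d (c ∘ ι) := by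
  refine ⟨by rw [← sum_extend_zero hι, extend_comp_of_le hι hc, h.1], ?_⟩
  refine le_trans ?_ h.2
  rw [← Finset.card_map ⟨ι, hι⟩]
  refine Finset.card_le_card fun j hj => ?_
  obtain ⟨i, hi, rfl⟩ := Finset.mem_map.1 hj
  simpa using hi

end Transfer

/-! ### Factorizations into arbitrarily many monomials -/

section Factorizations

variable {σ : Type*} [Fintype σ] {s d : ℕ} {A : Type*} [CommMonoid A]

theorem exists_injective_fin (hσ : Fintype.card σ + 1 ≤ 2 * s) :
    ∃ ι : σ → Fin (2 * s - 1), ι.Injective :=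
  ⟨_, ((Fin.castLEEmb (show Fintype.card σ ≤ 2 * s - 1 by omega)).injective).comp
    (Fintype.equivFin σ).injective⟩

/-- A monomial of degree `2 d` in at most `2 s - 1` variables is a product of two monomials of
degree `d` in at most `s` variables each. -/
theorem exists_isSmall_add (hσ : Fintype.card σ + 1 ≤ 2 * s) {w : σ → ℕ}
    (hw : ∑ i, w i = 2 * d) : ∃ c e, IsSmall s d c ∧ IsSmall s d e ∧ c + e = w := by
  obtain ⟨ι, hι⟩ := exists_injective_fin hσ
  obtain ⟨c, e, hc, he, hce⟩ := exists_isSmall_split (s := s) (d := d)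
    (by rw [Fintype.card_fin]; omega) ((sum_extend_zero hι w).trans hw)
  refine ⟨c ∘ ι, e ∘ ι, hc.restrict hι (w := w) ?_, he.restrict hι (w := w) ?_, ?_⟩
  · rw [← hce]; exact le_self_add
  · rw [← hce]; exact le_add_self
  · funext i
    have := congrFun hce (ι i)
    rwa [hι.extend_apply] at this

/-- The case of at most `2 s - 1` variables reduces to that of exactly `2 s - 1` variables by
adding variables which do not occur. -/
theorem triple_mul_eq (hσ : Fintype.card σ + 1 ≤ 2 * s) (hs : 2 ≤ s) {W : (σ → ℕ) → A}
    (hW : ∀ a₁ a₂ a₁' a₂', IsSmall s d a₁ → IsSmall s d a₂ → IsSmall s d a₁' → IsSmall s d a₂' →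
      a₁ + a₂ = a₁' + a₂' → W a₁ * W a₂ = W a₁' * W a₂') {m₁ m₂ m₃ m₁' m₂' m₃' : σ → ℕ}
    (h₁ : IsSmall s d m₁) (h₂ : IsSmall s d m₂) (h₃ : IsSmall s d m₃)
    (h₁' : IsSmall s d m₁') (h₂' : IsSmall s d m₂') (h₃' : IsSmall s d m₃')
    (h : m₁ + m₂ + m₃ = m₁' + m₂' + m₃') : W m₁ * W m₂ * W m₃ = W m₁' * W m₂' * W m₃' := by
  obtain ⟨ι, hι⟩ := exists_injective_fin hσ
  have hW' : IsExchangeable s d (Function.extend ι (m₁ + m₂ + m₃) 0)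
      (fun a : Fin (2 * s - 1) → ℕ => W (a ∘ ι)) := by
    intro a₁ a₂ a₁' a₂' ha₁ ha₂ ha₁' ha₂' hle heq
    have hle' := hle
    rw [heq] at hle'
    exact hW _ _ _ _ (ha₁.restrict hι (le_self_add.trans hle))
      (ha₂.restrict hι (le_add_self.trans hle)) (ha₁'.restrict hι (le_self_add.trans hle'))
      (ha₂'.restrict hι (le_add_self.trans hle')) (funext fun i => congrFun heq (ι i))
  have := hW'.triple_eq (by rw [Fintype.card_fin]; omega) hs (h₁.extend hι) (h₂.extend hι)
    (h₃.extend hι) (h₁'.extend hι) (h₂'.extend hι) (h₃'.extend hι)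
    (by rw [extend_add_extend hι, extend_add_extend hι])
    (by rw [extend_add_extend hι, extend_add_extend hι, h])
  simpa only [Function.extend_comp hι] using this

theorem exists_isSmall_multiset (hσ : Fintype.card σ + 1 ≤ 2 * s) {k : ℕ} (hk : 2 ≤ k) :
    ∀ {w : σ → ℕ}, ∑ i, w i = k * d →
      ∃ S : Multiset (σ → ℕ), S.card = k ∧ (∀ a ∈ S, IsSmall s d a) ∧ S.sum = w := by
  classical
  induction k, hk using Nat.le_induction with
  | base =>
    intro w hw
    obtain ⟨c, e, hc, he, hce⟩ := exists_isSmall_add hσ hw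
    exact ⟨{c, e}, by simp, by simp [hc, he], by simp [hce]⟩
  | succ k hk ih =>
    intro w hw
    have hkd : 2 * d ≤ k * d := Nat.mul_le_mul_right _ hk
    rw [add_mul, one_mul] at hw
    obtain ⟨u, t, rfl, hu⟩ := exists_le_sum_eq (w := w) (p := 2 * d) (by omega)
    obtain ⟨c, e, hc, he, rfl⟩ := exists_isSmall_add hσ hu
    simp only [Pi.add_apply, Finset.sum_add_distrib, hc.1, he.1] at hw
    obtain ⟨S, hS, hSs, hSw⟩ := ih (w := e + t) (by
      simp only [Pi.add_apply, Finset.sum_add_distrib, he.1]; omega)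
    exact ⟨c ::ₘ S, by simp [hS], by simpa [hc] using hSs, by simp [hSw, add_assoc]⟩

/-- Two factorizations of the same monomial into equally many monomials of degree `d` in at most
`s` variables have the same value. With at least four factors, a factor `m` of the one and a factor
`m'` of the other leave room for a small monomial `c` dividing both cofactors. -/
theorem prod_map_eq_of_isSmall (hσ : Fintype.card σ + 1 ≤ 2 * s) (hs : 2 ≤ s)
    {W : (σ → ℕ) → A}
    (hW : ∀ a₁ a₂ a₁' a₂', IsSmall s d a₁ → IsSmall s d a₂ → IsSmall s d a₁' → IsSmall s d a₂' →
      a₁ + a₂ = a₁' + a₂' → W a₁ * W a₂ = W a₁' * W a₂') (k : ℕ) :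
    ∀ S T : Multiset (σ → ℕ), S.card = k → T.card = k → (∀ a ∈ S, IsSmall s d a) →
      (∀ a ∈ T, IsSmall s d a) → S.sum = T.sum → (S.map W).prod = (T.map W).prod := by
  classical
  induction k with
  | zero =>
    intro S T hS hT _ _ _
    rw [Multiset.card_eq_zero.1 hS, Multiset.card_eq_zero.1 hT]
  | succ k ih =>
    intro S T hS hT hSs hTs h
    rcases Nat.lt_or_ge k 3 with hk | hk
    · interval_cases k
      · obtain ⟨a, rfl⟩ := Multiset.card_eq_one.1 hS
        obtain ⟨b, rfl⟩ := Multiset.card_eq_one.1 hT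
        simp only [Multiset.sum_singleton] at h
        rw [h]
      · obtain ⟨a₁, a₂, rfl⟩ := Multiset.card_eq_two.1 hS
        obtain ⟨b₁, b₂, rfl⟩ := Multiset.card_eq_two.1 hT
        simp at h hSs hTs ⊢
        exact hW _ _ _ _ hSs.1 hSs.2 hTs.1 hTs.2 h
      · obtain ⟨a₁, a₂, a₃, rfl⟩ := Multiset.card_eq_three.1 hS
        obtain ⟨b₁, b₂, b₃, rfl⟩ := Multiset.card_eq_three.1 hT
        simp [← mul_assoc, ← add_assoc] at h hSs hTs ⊢
        exact triple_mul_eq hσ hs hW hSs.1 hSs.2.1 hSs.2.2 hTs.1 hTs.2.1 hTs.2.2 h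
    obtain ⟨m, hm⟩ := Multiset.card_pos_iff_exists_mem.1 (show 0 < S.card by omega)
    obtain ⟨S, rfl⟩ := Multiset.exists_cons_of_mem hm
    obtain ⟨m', hm'⟩ := Multiset.card_pos_iff_exists_mem.1 (show 0 < T.card by omega)
    obtain ⟨T, rfl⟩ := Multiset.exists_cons_of_mem hm'
    simp only [Multiset.card_cons, Nat.add_right_cancel_iff, Multiset.mem_cons,
      forall_eq_or_imp, Multiset.sum_cons, Multiset.map_cons, Multiset.prod_cons] at *
    have hdeg : ∀ U : Multiset (σ → ℕ), (∀ a ∈ U, IsSmall s d a) →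
        ∑ i, U.sum i = U.card * d := by
      intro U
      induction U using Multiset.induction_on with
      | empty => simp
      | cons a U ihU =>
        intro hU
        simp only [Multiset.mem_cons, forall_eq_or_imp] at hU
        simp only [Multiset.sum_cons, Pi.add_apply, Finset.sum_add_distrib, hU.1.1, ihU hU.2,
          Multiset.card_cons]
        ring
    -- the variables remaining after the removal of the least common multiple of `m` and `m'`
    let g : σ → ℕ := fun i => m i ⊔ m' i
    have hg : ∃ r, g + r = m + S.sum := by
      refine ⟨m + S.sum - g, add_tsub_cancel_of_le fun i => ?_⟩
      have := congrFun h i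
      simp only [Pi.add_apply, g] at this ⊢
      omega
    obtain ⟨r, hr⟩ := hg
    have hkd : 3 * d ≤ k * d := Nat.mul_le_mul_right _ hk
    have hrd : 2 * d ≤ ∑ i, r i := by
      have h1 : ∑ i, (g + r) i = ∑ i, (m + S.sum) i := by rw [hr]
      have h2 : ∑ i, g i ≤ ∑ i, (m i + m' i) :=
        Finset.sum_le_sum fun i _ => by simp only [g]; omega
      simp only [Pi.add_apply, Finset.sum_add_distrib, hdeg S hSs.2, hSs.1.1, hTs.1.1, hS]
        at h1 h2
      omega
    obtain ⟨u, t, rfl, hu⟩ := exists_le_sum_eq hrd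
    obtain ⟨c, e, hc, -, rfl⟩ := exists_isSmall_add hσ hu
    have key : ∀ (n : σ → ℕ) (U : Multiset (σ → ℕ)), n ≤ g → IsSmall s d n → U.card = k →
        (∀ a ∈ U, IsSmall s d a) → n + U.sum = m + S.sum →
        ∃ V : Multiset (σ → ℕ), V.card + 1 = k ∧ (∀ a ∈ V, IsSmall s d a) ∧
          n + V.sum = (g - m) + m + e + t ∧
            W n * (U.map W).prod = W c * (W n * (V.map W).prod) := by
      intro n U hng hn hU hUs hUsum
      have hw : U.sum = c + ((g - n) + e + t) := by
        funext i
        have h1 := congrFun hUsum i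
        have h2 := congrFun hr i
        have h3 : n i ≤ g i := hng i
        simp only [Pi.add_apply, Pi.sub_apply] at h1 h2 ⊢
        omega
      have hwd := hdeg U hUs
      obtain ⟨l, rfl⟩ : ∃ l, k = l + 1 := ⟨k - 1, by omega⟩
      rw [hw, hU] at hwd
      simp only [Pi.add_apply c, Finset.sum_add_distrib (f := c), hc.1] at hwd
      obtain ⟨V, hV, hVs, hVsum⟩ := exists_isSmall_multiset (d := d) hσ (k := l) (by omega)
        (w := (g - n) + e + t) (by rw [add_mul] at hwd; omega)
      refine ⟨V, by omega, hVs, ?_, ?_⟩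
      · rw [hVsum]
        funext i
        have h3 : n i ≤ g i := hng i
        have h4 : m i ≤ g i := le_sup_left
        simp only [Pi.add_apply, Pi.sub_apply]
        omega
      · rw [ih U (c ::ₘ V) hU (by simp [hV]) hUs (by simpa [hc] using hVs)
          (by rw [Multiset.sum_cons, hVsum, hw]), Multiset.map_cons, Multiset.prod_cons,
          mul_left_comm]
    obtain ⟨V, hV, hVs, hVsum, hVW⟩ := key m S (fun i => le_sup_left) hSs.1 hS hSs.2 rfl
    obtain ⟨V', hV', hVs', hVsum', hVW'⟩ := key m' T (fun i => le_sup_right) hTs.1 hT hTs.2 h.symm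
    have := ih (m ::ₘ V) (m' ::ₘ V') (by simpa using hV) (by simpa using hV')
      (by simpa [hSs.1] using hVs) (by simpa [hTs.1] using hVs')
      (by rw [Multiset.sum_cons, Multiset.sum_cons, hVsum, hVsum'])
    rw [Multiset.map_cons, Multiset.map_cons, Multiset.prod_cons, Multiset.prod_cons] at this
    rw [hVW, hVW', this]

/-- By exchanges of two factors, every factorization with at least two factors can be turned into
one whose factors have at most `s` variables. -/
theorem exists_isSmall_prod_map_eq (hσ : Fintype.card σ + 1 ≤ 2 * s) {Ω : Set (σ → ℕ)}
    (hΩ : ∀ a ∈ Ω, ∑ i, a i = d) (hsΩ : ∀ a, IsSmall s d a → a ∈ Ω) {W : (σ → ℕ) → A}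
    (hW : ∀ a₁ ∈ Ω, ∀ a₂ ∈ Ω, ∀ a₁' ∈ Ω, ∀ a₂' ∈ Ω,
      a₁ + a₂ = a₁' + a₂' → W a₁ * W a₂ = W a₁' * W a₂') {k : ℕ} (hk : 2 ≤ k) :
    ∀ S : Multiset (σ → ℕ), S.card = k → (∀ a ∈ S, a ∈ Ω) →
      ∃ T : Multiset (σ → ℕ), T.card = k ∧ (∀ a ∈ T, IsSmall s d a) ∧ T.sum = S.sum ∧
        (T.map W).prod = (S.map W).prod := by
  have pair : ∀ a ∈ Ω, ∀ b ∈ Ω, ∃ c e, IsSmall s d c ∧ IsSmall s d e ∧ c + e = a + b ∧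
      W c * W e = W a * W b := by
    intro a ha b hb
    obtain ⟨c, e, hc, he, hce⟩ := exists_isSmall_add (d := d) hσ (w := a + b) (by
      simp only [Pi.add_apply, Finset.sum_add_distrib, hΩ a ha, hΩ b hb]; omega)
    exact ⟨c, e, hc, he, hce, hW c (hsΩ c hc) e (hsΩ e he) a ha b hb hce⟩
  induction k, hk using Nat.le_induction with
  | base =>
    intro S hS hSΩ
    obtain ⟨a, b, rfl⟩ := Multiset.card_eq_two.1 hS
    simp only [Multiset.insert_eq_cons, Multiset.mem_cons, Multiset.mem_singleton,
      forall_eq_or_imp, forall_eq] at hSΩ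
    obtain ⟨c, e, hc, he, hce, h⟩ := pair a hSΩ.1 b hSΩ.2
    exact ⟨{c, e}, by simp, by simp [hc, he], by simpa using hce, by simpa using h⟩
  | succ k hk ih =>
    intro S hS hSΩ
    obtain ⟨a, ha⟩ := Multiset.card_pos_iff_exists_mem.1 (show 0 < S.card by omega)
    obtain ⟨S, rfl⟩ := Multiset.exists_cons_of_mem ha
    obtain ⟨T, hT, hTs, hTsum, hTW⟩ := ih S (by simpa using hS)
      fun x hx => hSΩ x (Multiset.mem_cons_of_mem hx)
    obtain ⟨b, hb⟩ := Multiset.card_pos_iff_exists_mem.1 (show 0 < T.card by omega)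
    obtain ⟨T, rfl⟩ := Multiset.exists_cons_of_mem hb
    simp only [Multiset.mem_cons, forall_eq_or_imp] at hTs
    obtain ⟨c, e, hc, he, hce, h⟩ := pair a (hSΩ a ha) b (hsΩ b hTs.1)
    refine ⟨c ::ₘ e ::ₘ T, by simpa using hT, by simpa [hc, he] using hTs.2, ?_, ?_⟩
    · rw [Multiset.sum_cons, Multiset.sum_cons, Multiset.sum_cons, ← hTsum, Multiset.sum_cons,
        ← add_assoc, ← add_assoc, hce]
    · rw [Multiset.map_cons, Multiset.map_cons, Multiset.map_cons, Multiset.prod_cons,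
        Multiset.prod_cons, Multiset.prod_cons, ← hTW, Multiset.map_cons, Multiset.prod_cons,
        ← mul_assoc, ← mul_assoc, h]

theorem prod_map_eq_of_sum_eq (hσ : Fintype.card σ + 1 ≤ 2 * s) (hs : 2 ≤ s) (hd : 0 < d)
    {Ω : Set (σ → ℕ)} (hΩ : ∀ a ∈ Ω, ∑ i, a i = d) (hsΩ : ∀ a, IsSmall s d a → a ∈ Ω)
    {W : (σ → ℕ) → A} (hW : ∀ a₁ ∈ Ω, ∀ a₂ ∈ Ω, ∀ a₁' ∈ Ω, ∀ a₂' ∈ Ω,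
      a₁ + a₂ = a₁' + a₂' → W a₁ * W a₂ = W a₁' * W a₂') {S T : Multiset (σ → ℕ)}
    (hS : ∀ a ∈ S, a ∈ Ω) (hT : ∀ a ∈ T, a ∈ Ω) (h : S.sum = T.sum) :
    (S.map W).prod = (T.map W).prod := by
  have hdeg : ∀ U : Multiset (σ → ℕ), (∀ a ∈ U, a ∈ Ω) → ∑ i, U.sum i = U.card * d := by
    intro U
    induction U using Multiset.induction_on with
    | empty => simp
    | cons a U ihU =>
      intro hU
      simp only [Multiset.mem_cons, forall_eq_or_imp] at hU
      simp only [Multiset.sum_cons, Pi.add_apply, Finset.sum_add_distrib, hΩ a hU.1, ihU hU.2,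
        Multiset.card_cons]
      ring
  have hcard : S.card = T.card := by
    have h1 := hdeg S hS
    rw [h, hdeg T hT] at h1
    exact (Nat.eq_of_mul_eq_mul_right hd h1).symm
  rcases Nat.lt_or_ge S.card 2 with hk | hk
  · rcases Nat.lt_or_ge S.card 1 with hk' | hk'
    · rw [Multiset.card_eq_zero.1 (show S.card = 0 by omega),
        Multiset.card_eq_zero.1 (show T.card = 0 by omega)]
    · obtain ⟨a, rfl⟩ := Multiset.card_eq_one.1 (show S.card = 1 by omega)
      obtain ⟨b, rfl⟩ := Multiset.card_eq_one.1 (show T.card = 1 by omega)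
      simp only [Multiset.sum_singleton] at h
      rw [h]
  · obtain ⟨S', hS', hSs, hSsum, hSW⟩ := exists_isSmall_prod_map_eq hσ hΩ hsΩ hW hk S rfl hS
    obtain ⟨T', hT', hTs, hTsum, hTW⟩ :=
      exists_isSmall_prod_map_eq hσ hΩ hsΩ hW hk T hcard.symm hT
    rw [← hSW, ← hTW]
    exact prod_map_eq_of_isSmall hσ hs (fun a₁ a₂ a₁' a₂' h₁ h₂ h₁' h₂' =>
      hW a₁ (hsΩ _ h₁) a₂ (hsΩ _ h₂) a₁' (hsΩ _ h₁') a₂' (hsΩ _ h₂')) _ S' T' hS' hT' hSs hTs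
      (by rw [hSsum, hTsum, h])

end Factorizations

/-! ### The defining ideal -/

section Algebra

variable {K : Type*} [Field K] {n : ℕ} {Ω : Set (Fin (n + 1) →₀ ℕ)}

theorem adjoin_range_monomialGenerators :
    Algebra.adjoin K (Set.range (monomialGenerators K Ω)) = ⊤ := by
  have h : Set.range (monomialGenerators K Ω) =
      (Subtype.val : monomialAlgebra K Ω → _) ⁻¹'
        ((fun a => MvPolynomial.monomial a (1 : K)) '' Ω) := by
    ext x
    constructor
    · rintro ⟨a, rfl⟩
      exact ⟨a.1, a.2, rfl⟩
    · rintro ⟨a, ha, hx⟩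
      exact ⟨⟨a, ha⟩, Subtype.ext hx⟩
  rw [h]
  exact Algebra.adjoin_adjoin_coe_preimage

theorem mem_definingIdeal_iff {p : MvPolynomial Ω K} :
    p ∈ definingIdeal K (monomialGenerators K Ω) ↔
      MvPolynomial.aeval (fun a : Ω => MvPolynomial.monomial a.1 (1 : K)) p = 0 := by
  have h : (monomialAlgebra K Ω).val.comp (MvPolynomial.aeval (monomialGenerators K Ω)) =
      MvPolynomial.aeval (fun a : Ω => MvPolynomial.monomial a.1 (1 : K)) := by
    ext a
    simp [monomialGenerators]
  rw [definingIdeal, RingHom.mem_ker, ← h, AlgHom.comp_apply]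
  exact (map_eq_zero_iff (monomialAlgebra K Ω).val Subtype.val_injective).symm

theorem prod_map_monomial (S : Multiset Ω) :
    (S.map fun a => MvPolynomial.monomial a.1 (1 : K)).prod =
      MvPolynomial.monomial (S.map Subtype.val).sum 1 := by
  induction S using Multiset.induction_on with
  | empty => simp
  | cons a S ih => simp [ih, MvPolynomial.monomial_mul]

/-- If `f` sends the variables of `K[w_m : m ∈ Ω]` to elements of an algebra so that products of
values depend only on the product of the corresponding monomials, then the polynomials of the
defining ideal are relations between the values of `f`: evaluation at `f` factors linearly through
`K[x₀, …, xₙ]`. -/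
theorem aeval_eq_zero_of_mem_definingIdeal {B : Type*} [CommRing B] [Algebra K B] {f : Ω → B}
    (hf : ∀ S T : Multiset Ω, (S.map Subtype.val).sum = (T.map Subtype.val).sum →
      (S.map f).prod = (T.map f).prod) {p : MvPolynomial Ω K}
    (hp : p ∈ definingIdeal K (monomialGenerators K Ω)) : MvPolynomial.aeval f p = 0 := by
  classical
  let g : (Fin (n + 1) →₀ ℕ) → B := fun b =>
    if h : ∃ S : Multiset Ω, (S.map Subtype.val).sum = b then (h.choose.map f).prod else 0
  have hg : ∀ S : Multiset Ω, g (S.map Subtype.val).sum = (S.map f).prod := by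
    intro S
    have h : ∃ T : Multiset Ω, (T.map Subtype.val).sum = (S.map Subtype.val).sum := ⟨S, rfl⟩
    simp only [g, dif_pos h]
    exact hf _ _ h.choose_spec
  let ψ := (MvPolynomial.basisMonomials (Fin (n + 1)) K).constr K g
  have hψ : ∀ b, ψ (MvPolynomial.monomial b 1) = g b := fun b => by
    have := (MvPolynomial.basisMonomials (Fin (n + 1)) K).constr_basis K g b
    rwa [MvPolynomial.coe_basisMonomials] at this
  have key : ψ ∘ₗ (MvPolynomial.aeval
      (fun a : Ω => MvPolynomial.monomial a.1 (1 : K))).toLinearMap =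
      (MvPolynomial.aeval f).toLinearMap := by
    refine (MvPolynomial.basisMonomials Ω K).ext fun m => ?_
    have hm : MvPolynomial.monomial m (1 : K) =
        ((Finsupp.toMultiset m).map MvPolynomial.X).prod := by
      rw [MvPolynomial.monomial_eq, Finsupp.toMultiset_map, Finsupp.prod_toMultiset]
      simp [Finsupp.prod_mapDomain_index, pow_add]
    rw [MvPolynomial.coe_basisMonomials]
    beta_reduce
    rw [hm]
    simp only [LinearMap.comp_apply, AlgHom.toLinearMap_apply, map_multiset_prod,
      Multiset.map_map, Function.comp_def, MvPolynomial.aeval_X]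
    rw [prod_map_monomial, hψ, hg]
  have := LinearMap.congr_fun key p
  simp only [LinearMap.comp_apply, AlgHom.toLinearMap_apply, mem_definingIdeal_iff.1 hp,
    map_zero] at this
  exact this.symm

theorem X_mul_X_sub_mem_definingIdeal {a₁ a₂ a₁' a₂' : Ω}
    (h : a₁.1 + a₂.1 = a₁'.1 + a₂'.1) :
    (MvPolynomial.X a₁ * MvPolynomial.X a₂ - MvPolynomial.X a₁' * MvPolynomial.X a₂' :
      MvPolynomial Ω K) ∈ definingIdeal K (monomialGenerators K Ω) := by
  rw [mem_definingIdeal_iff]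
  simp [MvPolynomial.monomial_mul, h]

/-- The algebra `K[Ω]` is quadratic if `Ω` contains all monomials in at most `s` variables, where
the number `n + 1` of all variables is at most `2 s - 1`. -/
theorem isQuadraticAlgebra_monomialGenerators {d s : ℕ} (hd : 2 ≤ d) (hs : 2 ≤ s)
    (hns : n + 2 ≤ 2 * s) (hΩ : Ω ⊆ monomialsOfDegree n d) (hsΩ : pinchedMonomials n d s ⊆ Ω) :
    IsQuadraticAlgebra K (monomialGenerators K Ω) := by
  classical
  refine ⟨adjoin_range_monomialGenerators, ?_⟩
  rw [GeneratedByQuadrics]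
  set J := Ideal.span {q : MvPolynomial Ω K |
    q ∈ definingIdeal K (monomialGenerators K Ω) ∧ q.IsHomogeneous 2} with hJ
  refine le_antisymm (Ideal.span_le.2 fun q hq => hq.1) fun p hp => ?_
  let f : Ω → MvPolynomial Ω K ⧸ J := fun a => Ideal.Quotient.mk J (MvPolynomial.X a)
  have hf2 : ∀ a₁ a₂ a₁' a₂' : Ω, a₁.1 + a₂.1 = a₁'.1 + a₂'.1 →
      f a₁ * f a₂ = f a₁' * f a₂' := by
    intro a₁ a₂ a₁' a₂' h
    simp only [f, ← map_mul]
    refine Ideal.Quotient.eq.2 (Ideal.subset_span ⟨X_mul_X_sub_mem_definingIdeal h, ?_⟩)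
    exact ((MvPolynomial.isHomogeneous_X K a₁).mul (MvPolynomial.isHomogeneous_X K a₂)).sub
      ((MvPolynomial.isHomogeneous_X K a₁').mul (MvPolynomial.isHomogeneous_X K a₂'))
  let φ : (Fin (n + 1) →₀ ℕ) ≃+ (Fin (n + 1) → ℕ) :=
    { Finsupp.equivFunOnFinite with map_add' := fun a b => rfl }
  -- the value of `W` outside `Ω` is irrelevant
  let W : (Fin (n + 1) → ℕ) → MvPolynomial Ω K ⧸ J := fun a =>
    if h : φ.symm a ∈ Ω then f ⟨φ.symm a, h⟩ else 1
  have hWf : ∀ a : Ω, W (φ a.1) = f a := by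
    intro a
    simp [W]
  have hf : ∀ S T : Multiset Ω, (S.map Subtype.val).sum = (T.map Subtype.val).sum →
      (S.map f).prod = (T.map f).prod := by
    intro S T h
    have hmap : ∀ S : Multiset Ω, ((S.map fun a => φ a.1).map W).prod = (S.map f).prod := by
      intro S
      rw [Multiset.map_map]
      congr 1
      exact Multiset.map_congr rfl fun a _ => hWf a
    have hsum : ∀ S : Multiset Ω, (S.map fun a => φ a.1).sum = φ (S.map Subtype.val).sum := by
      intro S
      rw [map_multiset_sum, Multiset.map_map]
      rfl
    rw [← hmap S, ← hmap T]
    refine prod_map_eq_of_sum_eq (s := s) (d := d) (Ω := φ '' Ω) (by rw [Fintype.card_fin]; omega)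
      hs (by omega) ?_ ?_ ?_ ?_ ?_ (by rw [hsum, hsum, h])
    · rintro _ ⟨a, ha, rfl⟩
      have := hΩ ha
      rw [monomialsOfDegree, Set.mem_ofPred_eq, Finsupp.degree_eq_sum] at this
      exact this
    · intro a ha
      refine ⟨φ.symm a, hsΩ ⟨?_, ?_⟩, φ.apply_symm_apply a⟩
      · rw [monomialsOfDegree, Set.mem_ofPred_eq, Finsupp.degree_eq_sum]
        exact ha.1
      · refine le_trans (Finset.card_le_card fun i hi => ?_) ha.2
        exact mem_varSupport.2 (Finsupp.mem_support_iff.1 hi)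
    · rintro _ ⟨a₁, h₁, rfl⟩ _ ⟨a₂, h₂, rfl⟩ _ ⟨a₁', h₁', rfl⟩ _ ⟨a₂', h₂', rfl⟩ h
      rw [← map_add, ← map_add] at h
      have := hf2 ⟨a₁, h₁⟩ ⟨a₂, h₂⟩ ⟨a₁', h₁'⟩ ⟨a₂', h₂'⟩ (φ.injective h)
      simpa only [← hWf] using this
    · intro a ha
      obtain ⟨x, -, rfl⟩ := Multiset.mem_map.1 ha
      exact ⟨x.1, x.2, rfl⟩
    · intro a ha
      obtain ⟨x, -, rfl⟩ := Multiset.mem_map.1 ha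
      exact ⟨x.1, x.2, rfl⟩
  have h0 := aeval_eq_zero_of_mem_definingIdeal hf hp
  have hmk : MvPolynomial.aeval f = Ideal.Quotient.mkₐ K J := by
    ext a
    simp [f]
  rw [hmk] at h0
  exact Ideal.Quotient.eq_zero_iff_mem.1 h0

end Algebra

theorem theorem3p6 (K : Type*) [Field K] (n d : ℕ) (hn : 2 ≤ n) (hd : 2 ≤ d) :
    (∀ Ω : Set (Fin (n + 1) →₀ ℕ), Ω ⊆ monomialsOfDegree n d →
      pinchedMonomials n d ⌈((n : ℚ) + 2) / 2⌉₊ ⊆ Ω →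
      IsQuadraticAlgebra K (monomialGenerators K Ω)) ∧
    (∀ s : ℕ, ⌈((n : ℚ) + 2) / 2⌉₊ ≤ s →
      IsQuadraticAlgebra K (pinchedVeroneseGenerators K n d s)) := by
  have hns : n + 2 ≤ 2 * ⌈((n : ℚ) + 2) / 2⌉₊ := by
    have h := Nat.le_ceil (((n : ℚ) + 2) / 2)
    rw [div_le_iff₀ (by norm_num)] at h
    have : n + 2 ≤ ⌈((n : ℚ) + 2) / 2⌉₊ * 2 := by exact_mod_cast h
    omega
  refine ⟨fun Ω hΩ hsΩ => isQuadraticAlgebra_monomialGenerators hd (by omega) hns hΩ hsΩ,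
    fun s hs => ?_⟩
  exact isQuadraticAlgebra_monomialGenerators hd (by omega) hns (fun a ha => ha.1)
    fun a ha => ⟨ha.1, ha.2.trans hs⟩
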